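/- For $P=(x,y)\in\mathbb{C}^2$ put $d(P)=x^2+y^2$. Let $G=(V,E)$ be a finite simple graph. A complex realisation of $G$ is a map $p:V\to\mathbb{C}^2$; it is generic if the $2|V|$ coordinates of the points $p(v)$, $v\in V$, are algebraically independent over $\mathbb{Q}$. Realisations $p,q$ of $G$ are equivalent if $d(p(u)-p(v))=d(q(u)-q(v))$ for all $uv\in E$, and congruent if this equality holds for all $u,v\in V$. Let $c(G,p)$ be the number of congruence classes in the set of all complex realisations of $G$ that are equivalent to $p$. If $c(G,p)$ has the same value for all generic complex realisations $p$ of $G$, then this common value is denoted by $c(G)$. Let $\mathcal{QS}$ be the smallest family of graphs, closed under isomorphism, such that (i) $K_3\in\mathcal{QS}$, and (ii) whenever $G_1,G_2\in\mathcal{QS}$ are vertex-disjoint, $u_1,v_1$ are two distinct (adjacent or non-adjacent) vertices of $G_1$, and $e=u_2v_2$ is an edge of $G_2$, the graph obtained from $G_1$ and $G_2-e$ by identifying $u_1$ with $u_2$ and $v_1$ with $v_2$ belongs to $\mathcal{QS}$. Theorem. For every $G\in\mathcal{QS}$, generic complex realisations of $G$ exist, and every generic complex realisation $p$ of $G$ satisfies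 $c(G,p)=2^{|V|-3}$; that is, $c(G)=2^{|V|-3}$. -/

import Mathlib

universe u

/-- The squared length `d(x, y) = x ^ 2 + y ^ 2` of a point of `ℂ²` (no complex conjugation). -/
def sqLength (P : Fin 2 → ℂ) : ℂ := P 0 ^ 2 + P 1 ^ 2

/-- A complex realisation `p : V → ℂ²` is generic if the coordinates of its points
form an algebraically independent family over `ℚ`. -/
def IsGeneric {V : Type u} (p : V → Fin 2 → ℂ) : Prop :=
  AlgebraicIndependent ℚ (fun i : V × Fin 2 => p i.1 i.2)

/-- `(G, p)` and `(G, q)` are equivalent: all edges have the same squared length. -/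
def AreEquivalent {V : Type u} (G : SimpleGraph V) (p q : V → Fin 2 → ℂ) : Prop :=
  ∀ v w : V, G.Adj v w → sqLength (p v - p w) = sqLength (q v - q w)

/-- `p` and `q` are congruent: all pairs of vertices have the same squared distance. -/
def AreCongruent {V : Type u} (p q : V → Fin 2 → ℂ) : Prop :=
  ∀ v w : V, sqLength (p v - p w) = sqLength (q v - q w)

/-- Congruence as an equivalence relation on the set of all complex realisations of `G`
that are equivalent to `(G, p)`. -/
def congruenceSetoid {V : Type u} (G : SimpleGraph V) (p : V → Fin 2 → ℂ) :
    Setoid {q : V → Fin 2 → ℂ // AreEquivalent G p q} where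
  r q q' := AreCongruent q.1 q'.1
  iseqv :=
    ⟨fun _ _ _ => rfl, fun h v w => (h v w).symm, fun h h' v w => (h v w).trans (h' v w)⟩

/-- `c(G, p)`: the number of congruence classes in the set of all complex realisations
of `G` that are equivalent to `(G, p)`, with value `⊤` if there are infinitely many. -/
noncomputable def complexCount {V : Type u} (G : SimpleGraph V) (p : V → Fin 2 → ℂ) : ℕ∞ :=
  ENat.card (Quotient (congruenceSetoid G p))

/-- `c(G) = k`: the number `c(G, p)` has the value `k` for all generic complex
realisations `p` of `G`, and there are such realisations. -/
def GenericComplexCountEq {V : Type u} (G : SimpleGraph V) (k : ℕ∞) : Prop :=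
  (∃ p : V → Fin 2 → ℂ, IsGeneric p) ∧
    ∀ p : V → Fin 2 → ℂ, IsGeneric p → complexCount G p = k

/-- `G` is obtained from `G₁` and `G₂ - u₂v₂`, where `u₂v₂` is an edge of `G₂`, by gluing along
`u₁ = u₂` and `v₁ = v₂`. The maps `f₁` and `f₂` place the vertices of the two pieces in `G`:
they cover `V`, and the two copies share exactly the two glued vertices. -/
structure IsGluing {V V₁ V₂ : Type u} (G : SimpleGraph V)
    (G₁ : SimpleGraph V₁) (u₁ v₁ : V₁) (G₂ : SimpleGraph V₂) (u₂ v₂ : V₂)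
    (f₁ : V₁ ↪ V) (f₂ : V₂ ↪ V) : Prop where
  ne : u₁ ≠ v₁
  adj : G₂.Adj u₂ v₂
  glue_u : f₁ u₁ = f₂ u₂
  glue_v : f₁ v₁ = f₂ v₂
  cover : Set.range f₁ ∪ Set.range f₂ = Set.univ
  overlap : Set.range f₁ ∩ Set.range f₂ = {f₁ u₁, f₁ v₁}
  graph_eq : G = G₁.map f₁ ⊔ (G₂.deleteEdges {s(u₂, v₂)}).map f₂

/-- The recursively defined family of quadratically solvable graphs: it contains the complete
graphs on three vertices, and with `G₁` and `G₂` every graph obtained by gluing `G₁` and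
`G₂ - e` along two vertices of `G₁` and the end vertices of an edge `e` of `G₂`. -/
inductive IsQS : {V : Type u} → SimpleGraph V → Prop
  | triangle {V : Type u} (hV : Nat.card V = 3) : IsQS (⊤ : SimpleGraph V)
  | glue {V V₁ V₂ : Type u} {G : SimpleGraph V} {G₁ : SimpleGraph V₁} {G₂ : SimpleGraph V₂}
      {u₁ v₁ : V₁} {u₂ v₂ : V₂} {f₁ : V₁ ↪ V} {f₂ : V₂ ↪ V}
      (h₁ : IsQS G₁) (h₂ : IsQS G₂) (h : IsGluing G G₁ u₁ v₁ G₂ u₂ v₂ f₁ f₂) : IsQS G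

/-! In isotropic coordinates `(x + iy, x - iy)` squared length is a product. A configuration with
two distinguished vertices of distinct first coordinates is normalised by a translation and a
scaling `(tz, w/t)`; a congruence class then has exactly two normalised members, mirror images of
each other. So the claim is that there are `2 ^ (n - 2)` normalised realisations.

The induction counts realisations of any algebraically independent edge lengths `l`, not just those
of generic configurations. In a gluing, each realisation of `G₁` determines the squared distance `d`
of the glued pair. This `d` is algebraic over the lengths of `G₁` and transcendental, hence
independent of the lengths kept from `G₂` (`IsGluing.indepOn₂`). The lengths prescribed for `G₂` are
thus again independent, every fibre of restriction to `G₁` has `2 ^ (n₂ - 2)` elements, and the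
counts multiply (`IsGluing.card_normalisedRealisations`).

Generic realisations have independent edge lengths because all distances are algebraic over the `2n
- 3` edge lengths (`HasQSProperties.isGood`). -/

/-! ### Algebraic closure and independence over `ℚ` in `ℂ` -/

/-- The relative algebraic closure of `ℚ(S)` in `ℂ`. -/
noncomputable def acl (S : Set ℂ) : Subfield ℂ :=
  { ((Subalgebra.algebraicClosure (Algebra.adjoin ℚ S) ℂ).toSubring : Subring ℂ) with
    inv_mem' := fun x hx => by
      have hx' : IsAlgebraic (Algebra.adjoin ℚ S) x := hx
      exact hx'.inv }

/-- This makes exchange and rank arguments from matroid theory available for algebraic dependence.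
-/
theorem coe_acl (S : Set ℂ) :
    (acl S : Set ℂ) = (AlgebraicIndependent.matroid ℚ ℂ).closure S := by
  rw [AlgebraicIndependent.matroid_closure_eq]; rfl

theorem mem_acl_iff_mem_closure {S : Set ℂ} {x : ℂ} :
    x ∈ acl S ↔ x ∈ (AlgebraicIndependent.matroid ℚ ℂ).closure S := by
  rw [← coe_acl]; rfl

theorem subset_acl (S : Set ℂ) : S ⊆ acl S := by
  rw [coe_acl]; exact Matroid.subset_closure _ _ (Set.subset_univ _)

theorem acl_mono {S T : Set ℂ} (h : S ⊆ T) : acl S ≤ acl T := by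
  intro x hx
  rw [mem_acl_iff_mem_closure] at *
  exact Matroid.closure_subset_closure _ h hx

theorem acl_le {S T : Set ℂ} (h : S ⊆ acl T) : acl S ≤ acl T := by
  intro x hx
  rw [mem_acl_iff_mem_closure] at *
  rw [coe_acl] at h
  exact Matroid.closure_subset_closure_of_subset_closure h hx

theorem mem_acl_of_pow {S : Set ℂ} {x : ℂ} {n : ℕ} (hn : 0 < n) (h : x ^ n ∈ acl S) :
    x ∈ acl S :=
  IsAlgebraic.of_pow hn h

theorem mem_acl_of_quadratic {S : Set ℂ} {a b c x : ℂ} (ha : a ∈ acl S) (hb : b ∈ acl S)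
    (hc : c ∈ acl S) (ha0 : a ≠ 0) (h : a * x ^ 2 + b * x + c = 0) : x ∈ acl S := by
  have h4 : (4 : ℂ) ∈ acl S := ofNat_mem _ 4
  have h2 : (2 : ℂ) ∈ acl S := ofNat_mem _ 2
  have hy : 2 * a * x + b ∈ acl S := by
    refine mem_acl_of_pow two_pos ?_
    have : (2 * a * x + b) ^ 2 = b ^ 2 - 4 * a * c := by linear_combination 4 * a * h
    rw [this]
    exact sub_mem (pow_mem hb 2) (mul_mem (mul_mem h4 ha) hc)
  have : x = (2 * a * x + b - b) / (2 * a) := by field_simp; ring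
  rw [this]
  exact div_mem (sub_mem hy hb) (mul_mem h2 ha)

theorem I_mem_acl (S : Set ℂ) : Complex.I ∈ acl S := by
  refine mem_acl_of_pow two_pos ?_
  rw [Complex.I_sq]
  exact neg_mem (one_mem _)

theorem AlgebraicIndependent.notMem_acl {ι : Type*} {x : ι → ℂ} (hx : AlgebraicIndependent ℚ x)
    {s : Set ι} {i : ι} (hi : i ∉ s) : x i ∉ acl (x '' s) :=
  hx.transcendental_adjoin hi

theorem mem_acl_exchange {S : Set ℂ} {x y : ℂ} (h : x ∈ acl (insert y S)) (hx : x ∉ acl S) :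
    y ∈ acl (insert x S) := by
  rw [mem_acl_iff_mem_closure] at *
  exact (Matroid.closure_exchange ⟨h, hx⟩).1

/-- If a finite algebraically independent family `x` is algebraic over a family `y` which is not
longer, then `y` is algebraically independent too, and algebraic over `x`. -/
theorem algebraicIndependent_of_subset_acl {ι κ : Type*} [Finite ι] [Finite κ] {x : ι → ℂ}
    {y : κ → ℂ} (hx : AlgebraicIndependent ℚ x) (hxy : Set.range x ⊆ acl (Set.range y))
    (hcard : Nat.card κ ≤ Nat.card ι) :
    AlgebraicIndependent ℚ y ∧ Set.range y ⊆ acl (Set.range x) := by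
  set M := AlgebraicIndependent.matroid ℚ ℂ with hM
  have hxi : M.Indep (Set.range x) := hx.to_subtype_range
  rw [coe_acl] at hxy
  have e1 : M.eRk (Set.range x) = Nat.card ι := by
    rw [hxi.eRk_eq_encard, ← Set.image_univ, hx.injective.encard_image, Set.encard_univ,
      ENat.card_eq_coe_natCard]
  have e2 : M.eRk (Set.range x) ≤ M.eRk (Set.range y) := by
    rw [← M.eRk_closure_eq (Set.range y)]; exact M.eRk_mono hxy
  have e3 : M.eRk (Set.range y) ≤ (Set.range y).encard := M.eRk_le_encard _
  have e4 : (Set.range y).encard ≤ Nat.card κ := by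
    rw [← Set.image_univ, ← ENat.card_eq_coe_natCard, ← Set.encard_univ]
    exact Set.encard_image_le _ _
  have hc : (Nat.card κ : ℕ∞) ≤ Nat.card ι := by exact_mod_cast hcard
  -- The chain `card ι = rk x ≤ rk y ≤ |range y| ≤ card κ ≤ card ι` closes up, so all its terms are
  -- equal.
  have e5 : M.eRk (Set.range y) = (Set.range y).encard :=
    le_antisymm e3 (e4.trans (hc.trans (e1 ▸ e2)))
  have e6 : (Set.range y).encard = Nat.card κ :=
    le_antisymm e4 (hc.trans (e1 ▸ e2.trans e3))
  have hinj : Function.Injective y := by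
    rw [← Set.injOn_univ]
    refine Set.Finite.injOn_of_encard_image_eq Set.finite_univ ?_
    rw [Set.image_univ, e6, Set.encard_univ, ENat.card_eq_coe_natCard]
  have hyi : M.Indep (Set.range y) :=
    (Matroid.indep_iff_eRk_eq_encard_of_finite (Set.finite_range y)).2 e5
  refine ⟨.of_subtype_range hinj hyi, ?_⟩
  have hfin : M.IsRkFinite (Set.range x) := M.isRkFinite_of_finite (Set.finite_range x)
  have := hfin.closure_eq_closure_of_subset_of_eRk_ge_eRk hxy (by
    rw [M.eRk_closure_eq, e1]; exact e3.trans (e4.trans hc))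
  rw [coe_acl, ← hM, this, M.closure_closure]
  exact M.subset_closure _ (Set.subset_univ _)

/-- If `d` is algebraic over one part of an algebraically independent family and not over `ℚ`, then
it is not algebraic over the rest of the family. -/
theorem notMem_acl_image_of_disjoint {ι : Type*} {x : ι → ℂ} {s t : Set ι} (ht : t.Finite)
    (hst : Disjoint s t) (hx : AlgebraicIndepOn ℚ x (s ∪ t)) {d : ℂ} (hd : d ∈ acl (x '' s))
    (hd0 : d ∉ acl ∅) : d ∉ acl (x '' t) := by
  induction t, ht using Set.Finite.induction_on with
  | empty => simpa using hd0
  | @insert b t hb ht ih =>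
    have hst' : Disjoint s t := hst.mono_right (Set.subset_insert _ _)
    have hbs : b ∉ s := fun h => Set.disjoint_left.1 hst h (Set.mem_insert _ _)
    have ih' := ih hst' (hx.mono (Set.union_subset_union_right _ (Set.subset_insert _ _)))
    intro hd1
    rw [Set.image_insert_eq] at hd1
    -- If adjoining `x b` makes `d` algebraic, exchange makes `x b` algebraic over `d` and the
    -- `t`-part, hence over `s ∪ t`.
    have h1 : x b ∈ acl (x '' (s ∪ t)) := by
      refine acl_le (Set.insert_subset ?_ ?_) (mem_acl_exchange hd1 ih')
      · exact acl_mono (Set.image_mono Set.subset_union_left) hd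
      · exact (Set.image_mono Set.subset_union_right).trans (subset_acl _)
    rw [Set.union_insert, AlgebraicIndepOn.insert_iff (by simp [hbs, hb])] at hx
    exact hx.2 h1

/-- A transcendence basis of `ℂ` over `ℚ` has the cardinality of the continuum, so it has room for
any finite family. -/
theorem exists_algebraicIndependent_complex (ι : Type*) [Finite ι] :
    ∃ x : ι → ℂ, AlgebraicIndependent ℚ x := by
  obtain ⟨s, hs⟩ := exists_isTranscendenceBasis ℚ ℂ
  have hinf : Infinite s := by
    have := IsAlgClosed.cardinal_eq_cardinal_transcendence_basis_of_aleph0_lt _ hs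
      (by simp) (by rw [Cardinal.mk_complex]; exact Cardinal.aleph0_lt_continuum)
    rw [Cardinal.mk_complex] at this
    rw [Cardinal.infinite_iff]
    simp at this
    rw [← this]
    exact Cardinal.aleph0_le_continuum
  obtain ⟨n, ⟨e⟩⟩ := Finite.exists_equiv_fin ι
  let f : ι ↪ s := e.toEmbedding.trans (Fin.valEmbedding.trans (Infinite.natEmbedding s))
  exact ⟨_, hs.1.comp f f.injective⟩

/-! ### Isotropic coordinates and normalisation -/

/-- The squared lengths of all pairs of points of a configuration in isotropic coordinates
`(x + iy, x - iy)`. -/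
def len {V : Type*} (q : V → ℂ × ℂ) : Sym2 V → ℂ :=
  Sym2.lift ⟨fun v w => ((q v).1 - (q w).1) * ((q v).2 - (q w).2), fun v w => by ring⟩

@[simp]
theorem len_mk {V : Type*} (q : V → ℂ × ℂ) (v w : V) :
    len q s(v, w) = ((q v).1 - (q w).1) * ((q v).2 - (q w).2) := rfl

theorem len_comp {V W : Type*} (q : V → ℂ × ℂ) (f : W → V) (e : Sym2 W) :
    len (q ∘ f) e = len q (e.map f) := by
  induction e with | _ v w => simp

/-- The image of a configuration under the orientation-preserving isometry which moves the point
of `a` to the origin and gives the point of `b` first isotropic coordinate `1`. -/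
noncomputable def renorm {V : Type*} (a b : V) (q : V → ℂ × ℂ) : V → ℂ × ℂ := fun v =>
  (((q v).1 - (q a).1) / ((q b).1 - (q a).1), ((q v).2 - (q a).2) * ((q b).1 - (q a).1))

theorem len_renorm {V : Type*} {a b : V} {q : V → ℂ × ℂ} (h : (q a).1 ≠ (q b).1) :
    len (renorm a b q) = len q := by
  have h' : (q b).1 - (q a).1 ≠ 0 := sub_ne_zero.2 h.symm
  funext e
  induction e with | _ v w => ?_
  simp only [len_mk, renorm]
  field_simp
  ring

/-- The configuration is normalised: the point of `a` is the origin, and the point of `b` has first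
isotropic coordinate `1`. -/
def IsNormalised {V : Type*} (a b : V) (q : V → ℂ × ℂ) : Prop := q a = 0 ∧ (q b).1 = 1

theorem isNormalised_renorm {V : Type*} {a b : V} {q : V → ℂ × ℂ} (h : (q a).1 ≠ (q b).1) :
    IsNormalised a b (renorm a b q) := by
  have h' : (q b).1 - (q a).1 ≠ 0 := sub_ne_zero.2 h.symm
  refine ⟨?_, ?_⟩
  · simp [renorm]
  · simp [renorm, h']

theorem IsNormalised.renorm_renorm {V : Type*} {a b c d : V} {q : V → ℂ × ℂ}
    (hq : IsNormalised a b q) (h : (q c).1 ≠ (q d).1) : renorm a b (renorm c d q) = q := by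
  have h' : (q d).1 - (q c).1 ≠ 0 := sub_ne_zero.2 h.symm
  obtain ⟨h1, h2⟩ := hq
  funext v
  ext
  · simp only [renorm, h1, h2, Prod.fst_zero]
    field_simp
    ring
  · simp only [renorm, h1, h2, Prod.snd_zero, Prod.fst_zero]
    field_simp
    ring

/-- The isotropic coordinates of a configuration which are not fixed by normalisation. -/
def freeCoord {V : Type*} (a b : V) (q : V → ℂ × ℂ) : {v // v ≠ a ∧ v ≠ b} ⊕ {v // v ≠ a} → ℂ :=
  Sum.elim (fun v => (q v).1) (fun v => (q v).2)

theorem card_freeCoord {V : Type*} [Finite V] {a b : V} (hab : a ≠ b) :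
    Nat.card ({v // v ≠ a ∧ v ≠ b} ⊕ {v // v ≠ a}) + 3 = 2 * Nat.card V := by
  classical
  have := Fintype.ofFinite V
  have h1 : Fintype.card {v // v ≠ a ∧ v ≠ b} = Fintype.card V - 2 := by
    rw [Fintype.card_subtype, ← Finset.card_pair hab, ← Finset.card_univ,
      ← Finset.card_sdiff_of_subset (Finset.subset_univ _)]
    congr 1; ext; simp
  have h2 : Fintype.card {v // v ≠ a} = Fintype.card V - 1 := by
    simp
  have h3 : 2 ≤ Fintype.card V := by
    rw [← Finset.card_pair hab]; exact Finset.card_le_univ _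
  rw [Nat.card_eq_fintype_card, Nat.card_eq_fintype_card, Fintype.card_sum]
  omega

theorem IsNormalised.coord_mem_acl {V : Type*} {a b : V} {q : V → ℂ × ℂ} {S : Set ℂ}
    (hq : IsNormalised a b q) (hS : Set.range (freeCoord a b q) ⊆ acl S) (v : V) :
    (q v).1 ∈ acl S ∧ (q v).2 ∈ acl S := by
  by_cases ha : v = a
  · subst ha; rw [hq.1]; exact ⟨zero_mem _, zero_mem _⟩
  refine ⟨?_, hS ⟨.inr ⟨v, ha⟩, rfl⟩⟩
  by_cases hb : v = b
  · subst hb; rw [hq.2]; exact one_mem _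
  · exact hS ⟨.inl ⟨v, ha, hb⟩, rfl⟩

theorem len_mem_acl {V : Type*} {q : V → ℂ × ℂ} {S : Set ℂ}
    (h : ∀ v, (q v).1 ∈ acl S ∧ (q v).2 ∈ acl S) (e : Sym2 V) : len q e ∈ acl S := by
  induction e with | _ v w => ?_
  exact mul_mem (sub_mem (h v).1 (h w).1) (sub_mem (h v).2 (h w).2)

/-! ### Configurations with algebraically independent edge lengths -/

/-- The edge lengths of a configuration of `G` are algebraically independent, and `G` has as many
edges as a minimally rigid graph. -/
structure IsGood {V : Type*} (G : SimpleGraph V) (q : V → ℂ × ℂ) : Prop where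
  card_edge : G.edgeSet.ncard + 3 = 2 * Nat.card V
  card_vert : 3 ≤ Nat.card V
  indep : AlgebraicIndepOn ℚ (len q) G.edgeSet

namespace IsGood

variable {V : Type*} {G : SimpleGraph V} {q : V → ℂ × ℂ} {a b c : V}

theorem renorm (hq : IsGood G q) (h : (q a).1 ≠ (q b).1) : IsGood G (renorm a b q) :=
  ⟨hq.1, hq.2, by rw [len_renorm h]; exact hq.3⟩

variable [Finite V]

/-- The `2n - 3` independent edge lengths are polynomials in the `2n - 3` free coordinates, so a
comparison of ranks gives both claims. -/
theorem freeCoord_indep (hq : IsGood G q) (hn : IsNormalised a b q) :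
    AlgebraicIndependent ℚ (freeCoord a b q) ∧
      Set.range (freeCoord a b q) ⊆ acl (len q '' G.edgeSet) := by
  have hab : a ≠ b := by
    rintro rfl
    have := hn.2
    rw [hn.1] at this
    simp at this
  have h := algebraicIndependent_of_subset_acl (y := freeCoord a b q) hq.indep (by
    rintro _ ⟨e, rfl⟩
    exact len_mem_acl (hn.coord_mem_acl (subset_acl _)) _) (by
    have h1 := card_freeCoord hab
    have h2 := hq.card_edge
    have h3 : Nat.card G.edgeSet = G.edgeSet.ncard := Nat.card_coe_set_eq _
    omega)
  refine ⟨h.1, h.2.trans ?_⟩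
  rw [Set.image_eq_range]

/-- Some `c` differs from `a` in first coordinate, as otherwise every edge length would vanish.
After normalising at `a, c`, the first coordinate of any further `b` is free, hence nonzero. -/
theorem fst_ne (hq : IsGood G q) (hab : a ≠ b) : (q a).1 ≠ (q b).1 := by
  obtain ⟨c, hc⟩ : ∃ c, (q a).1 ≠ (q c).1 := by
    by_contra! h
    have hne : G.edgeSet.Nonempty := by
      rw [← Set.ncard_pos]
      have := hq.card_edge
      have := hq.card_vert
      omega
    obtain ⟨e, he⟩ := hne
    refine hq.indep.ne_zero ⟨e, he⟩ ?_
    induction e with | _ v w => ?_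
    simp [← h v, ← h w]
  by_cases hbc : b = c
  · exact hbc ▸ hc
  have := (hq.renorm hc).freeCoord_indep (isNormalised_renorm hc)
  have := this.1.ne_zero (.inl ⟨b, hab.symm, hbc⟩)
  intro h
  simp [freeCoord, _root_.renorm, h] at this

theorem snd_notMem (hq : IsGood G q) (hn : IsNormalised a b q) (hc : c ≠ a) :
    (q c).2 ∉ acl ∅ := by
  have := (hq.freeCoord_indep hn).1.notMem_acl (s := ∅) (i := .inr ⟨c, hc⟩) (by simp)
  simpa [freeCoord] using this

/-- All squared distances are transcendental. -/
theorem len_notMem (hq : IsGood G q) (hab : a ≠ b) : len q s(a, b) ∉ acl ∅ := by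
  have h := hq.fst_ne hab
  have := (hq.renorm h).snd_notMem (isNormalised_renorm h) hab.symm
  rw [← len_renorm h]
  have h1 := isNormalised_renorm h
  rw [len_mk, h1.1, h1.2]
  simpa using this

theorem len_mem (hq : IsGood G q) (e : Sym2 V) : len q e ∈ acl (len q '' G.edgeSet) := by
  have : Nontrivial V := by
    rw [← Finite.one_lt_card_iff_nontrivial]
    have := hq.card_vert
    omega
  obtain ⟨a, b, hab⟩ := exists_pair_ne V
  have h := hq.fst_ne hab
  rw [← len_renorm h]
  exact len_mem_acl ((isNormalised_renorm h).coord_mem_acl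
    ((hq.renorm h).freeCoord_indep (isNormalised_renorm h)).2) _

/-- No three points are collinear. -/
theorem not_collinear (hq : IsGood G q) (hn : IsNormalised a b q) (hca : c ≠ a) (hcb : c ≠ b)
    (hba : b ≠ a) : (q c).2 ≠ (q c).1 * (q b).2 := by
  intro h
  -- Collinearity would express one free coordinate through two others.
  have := (hq.freeCoord_indep hn).1.notMem_acl (s := {.inl ⟨c, hca, hcb⟩, .inr ⟨b, hba⟩})
    (i := .inr ⟨c, hca⟩) (by simp [hcb])
  refine this ?_
  rw [Set.image_pair]
  change (q c).2 ∈ acl {(q c).1, (q b).2}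
  rw [h]
  exact mul_mem (subset_acl _ (by simp)) (subset_acl _ (by simp))

end IsGood

/-! ### Counting normalised configurations and mirror images -/

/-- The normalised configurations with edge lengths `l`. -/
def normalisedRealisations {V : Type*} (G : SimpleGraph V) (l : Sym2 V → ℂ) (a b : V) :
    Set (V → ℂ × ℂ) :=
  {q | IsNormalised a b q ∧ Set.EqOn (len q) l G.edgeSet}

theorem AlgebraicIndepOn.congr {ι : Type*} {x y : ι → ℂ} {s : Set ι}
    (hx : AlgebraicIndepOn ℚ x s) (h : Set.EqOn x y s) : AlgebraicIndepOn ℚ y s := by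
  have : (fun i : s => x i) = fun i : s => y i := funext fun i => h i.2
  unfold AlgebraicIndepOn at *
  rwa [← this]

/-- The cardinality of the domain of a map all of whose fibres have the same finite nonzero
cardinality. -/
theorem Nat.card_eq_mul_of_card_fiber {α β : Type*} (f : α → β) {m : ℕ} (hm : m ≠ 0)
    (h : ∀ b, Nat.card {a // f a = b} = m) : Nat.card α = Nat.card β * m := by
  have e (b : β) : {a // f a = b} ≃ Fin m :=
    -- `Nat.card` is `0` on infinite types, so `m ≠ 0` rules out infinite fibres.
    have : Finite {a // f a = b} := Nat.finite_of_card_ne_zero (h b ▸ hm)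
    Finite.equivFinOfCardEq (h b)
  rw [← Nat.card_congr (Equiv.sigmaFiberEquiv f), Nat.card_congr (Equiv.sigmaCongrRight e),
    Nat.card_congr (Equiv.sigmaEquivProd β (Fin m)), Nat.card_prod, Nat.card_fin]

section mirror

variable {V : Type*} {G : SimpleGraph V} {a b : V}

theorem card_normalisedRealisations_eq [Finite V] {l : Sym2 V → ℂ} {a' b' : V}
    (h1 : G.edgeSet.ncard + 3 = 2 * Nat.card V) (h2 : 3 ≤ Nat.card V)
    (hl : AlgebraicIndepOn ℚ l G.edgeSet) (hab : a ≠ b) (hab' : a' ≠ b') :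
    Nat.card (normalisedRealisations G l a b) = Nat.card (normalisedRealisations G l a' b') := by
  have key {c d c' d' : V} (hcd : c' ≠ d') (q : normalisedRealisations G l c d) :
      (q.1 c').1 ≠ (q.1 d').1 :=
    IsGood.fst_ne ⟨h1, h2, hl.congr q.2.2.symm⟩ hcd
  have key' {c d c' d' : V} (hcd : c' ≠ d') (q : normalisedRealisations G l c d) :
      renorm c' d' q.1 ∈ normalisedRealisations G l c' d' := by
    have h := key hcd q
    exact ⟨isNormalised_renorm h, by rw [len_renorm h]; exact q.2.2⟩
  exact Nat.card_congr
    { toFun := fun q => ⟨renorm a' b' q.1, key' hab' q⟩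
      invFun := fun q => ⟨renorm a b q.1, key' hab q⟩
      left_inv := fun q => Subtype.ext (q.2.1.renorm_renorm (key hab' q))
      right_inv := fun q => Subtype.ext (q.2.1.renorm_renorm (key hab q)) }

/-- The reflection of a normalised configuration in the line through the points of `a` and `b`. -/
noncomputable def mirror (b : V) (q : V → ℂ × ℂ) : V → ℂ × ℂ := fun v =>
  ((q v).2 / (q b).2, (q v).1 * (q b).2)

theorem len_mirror {q : V → ℂ × ℂ} (h : (q b).2 ≠ 0) : len (mirror b q) = len q := by
  funext e
  induction e with | _ v w => ?_
  simp only [len_mk, mirror]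
  field_simp

theorem IsNormalised.mirror {q : V → ℂ × ℂ} (hq : IsNormalised a b q) (h : (q b).2 ≠ 0) :
    IsNormalised a b (mirror b q) := by
  refine ⟨?_, ?_⟩
  · simp [_root_.mirror, hq.1]
  · simp [_root_.mirror, h]

/-- The distances to `a` and `b` leave a quadratic for each point, whose roots give the original and
its mirror image. The choices must agree with that at `c`, which lies off the axis `ab`: a mixed
choice at `v` keeps the distance `cv` only if `v` lies on the axis, where both choices coincide. -/
theorem IsNormalised.eq_or_eq_mirror {q q' : V → ℂ × ℂ} {c : V} (hq : IsNormalised a b q)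
    (hq' : IsNormalised a b q') (hlen : len q' = len q) (hb : (q b).2 ≠ 0)
    (hc : (q c).2 ≠ (q c).1 * (q b).2) : q' = q ∨ q' = _root_.mirror b q := by
  have hl (v w : V) := congrFun hlen s(v, w)
  simp only [len_mk] at hl
  have hd : (q' b).2 = (q b).2 := by
    have := hl a b
    simpa [hq.1, hq.2, hq'.1, hq'.2] using this
  have hv (v : V) : q' v = q v ∨ q' v = _root_.mirror b q v := by
    have h1 := hl v a
    have h2 := hl v b
    simp only [hq.1, hq.2, hq'.1, hq'.2, hd, Prod.fst_zero, Prod.snd_zero, sub_zero] at h1 h2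
    have h3 : ((q' v).1 - (q v).1) * ((q' v).1 * (q b).2 - (q v).2) = 0 := by
      linear_combination (q' v).1 * (h1 - h2) - h1
    rcases mul_eq_zero.1 h3 with h4 | h4
    · left
      have h5 := sub_eq_zero.1 h4
      refine Prod.ext h5 ?_
      rw [h5] at h1 h2
      linear_combination h1 - h2
    · right
      have h5 : (q' v).1 = (q v).2 / (q b).2 := by
        field_simp
        linear_combination h4
      refine Prod.ext h5 ?_
      change _ = (q v).1 * (q b).2
      linear_combination h1 - h2 - h4
  have hfix {v : V} (h : (q v).2 = (q v).1 * (q b).2) : _root_.mirror b q v = q v := by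
    refine Prod.ext ?_ h.symm
    change (q v).2 / (q b).2 = _
    rw [h]; field_simp
  have hprod {v : V} (h : ((q c).2 - (q c).1 * (q b).2) * ((q v).2 - (q v).1 * (q b).2) = 0) :
      _root_.mirror b q v = q v :=
    hfix (sub_eq_zero.1 ((mul_eq_zero.1 h).resolve_left (sub_ne_zero.2 hc)))
  rcases hv c with h | h
  · left
    funext v
    rcases hv v with h' | h'
    · exact h'
    · rw [h']
      apply hprod
      have := hl c v
      rw [h, h'] at this
      simp only [_root_.mirror] at this
      field_simp at this
      linear_combination -this
  · right
    funext v
    rcases hv v with h' | h'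
    · rw [h']
      symm
      apply hprod
      have := hl c v
      rw [h, h'] at this
      simp only [_root_.mirror] at this
      field_simp at this
      linear_combination -this
    · exact h'

/-- A normalised configuration with algebraically independent edge lengths shares its lengths with
exactly one other normalised configuration, its mirror image. -/
theorem IsGood.card_congruent [Finite V] {q : V → ℂ × ℂ} (hq : IsGood G q)
    (hn : IsNormalised a b q) : Nat.card {q' // IsNormalised a b q' ∧ len q' = len q} = 2 := by
  have hab : b ≠ a := by
    rintro rfl
    have := hn.2
    rw [hn.1] at this
    simp at this
  have hb : (q b).2 ≠ 0 := fun h => hq.snd_notMem hn hab (h ▸ zero_mem _)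
  obtain ⟨c, hca, hcb⟩ : ∃ c, c ≠ a ∧ c ≠ b := by
    by_contra! h
    have h3 : Set.univ ⊆ ({a, b} : Set V) := fun x _ => by
      by_cases hx : x = a
      · simp [hx]
      · simp [h x hx]
    have h4 := Set.ncard_le_ncard h3
    rw [Set.ncard_univ] at h4
    have h5 := Set.ncard_pair hab.symm
    have := hq.card_vert
    omega
  have hc := hq.not_collinear hn hca hcb hab
  have hset : {q' | IsNormalised a b q' ∧ len q' = len q} = {q, _root_.mirror b q} := by
    ext q'
    constructor
    · rintro ⟨h1, h2⟩
      exact hn.eq_or_eq_mirror h1 h2 hb hc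
    · rintro (rfl | rfl)
      · exact ⟨hn, rfl⟩
      · exact ⟨hn.mirror hb, len_mirror hb⟩
  have : Nat.card {q' | IsNormalised a b q' ∧ len q' = len q} = 2 := by
    rw [Nat.card_coe_set_eq, hset]
    refine Set.ncard_pair fun h => hc ?_
    exact congrArg Prod.snd (congrFun h c)
  exact this

end mirror

/-! ### Restricting to and assembling from the pieces of a gluing -/

namespace IsGluing

variable {V V₁ V₂ : Type u} {G : SimpleGraph V} {G₁ : SimpleGraph V₁} {G₂ : SimpleGraph V₂}
  {u₁ v₁ : V₁} {u₂ v₂ : V₂} {f₁ : V₁ ↪ V} {f₂ : V₂ ↪ V}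

theorem edgeSet_eq (h : IsGluing G G₁ u₁ v₁ G₂ u₂ v₂ f₁ f₂) :
    G.edgeSet = Sym2.map f₁ '' G₁.edgeSet ∪ Sym2.map f₂ '' (G₂.edgeSet \ {s(u₂, v₂)}) := by
  rw [h.graph_eq, SimpleGraph.edgeSet_sup, SimpleGraph.edgeSet_map, SimpleGraph.edgeSet_map,
    SimpleGraph.edgeSet_deleteEdges]
  rfl

theorem eq_or_eq (h : IsGluing G G₁ u₁ v₁ G₂ u₂ v₂ f₁ f₂) {x : V₁} {y : V₂} (hxy : f₁ x = f₂ y) :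
    (x = u₁ ∧ y = u₂) ∨ (x = v₁ ∧ y = v₂) := by
  have : f₁ x ∈ Set.range f₁ ∩ Set.range f₂ := ⟨⟨x, rfl⟩, ⟨y, hxy.symm⟩⟩
  rw [h.overlap] at this
  rcases this with h' | h'
  · exact .inl ⟨f₁.injective h', f₂.injective (by rw [← hxy, h', h.glue_u])⟩
  · exact .inr ⟨f₁.injective h', f₂.injective (by rw [← hxy, h', h.glue_v])⟩

/-- A common edge would have both ends among the glued vertices, so it would be the deleted edge. -/
theorem disjoint_edges (h : IsGluing G G₁ u₁ v₁ G₂ u₂ v₂ f₁ f₂) :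
    Disjoint (Sym2.map f₁ '' G₁.edgeSet) (Sym2.map f₂ '' (G₂.edgeSet \ {s(u₂, v₂)})) := by
  rw [Set.disjoint_left]
  rintro _ ⟨e, -, rfl⟩ ⟨e', ⟨he', hne⟩, hee'⟩
  induction e with | _ x y => ?_
  induction e' with | _ x' y' => ?_
  have hxy : x' ≠ y' := G₂.ne_of_adj he'
  simp only [Sym2.map_mk, Sym2.eq_iff] at hee'
  simp only [Set.mem_singleton_iff, Sym2.eq_iff, not_or] at hne
  rcases hee' with ⟨h1, h2⟩ | ⟨h1, h2⟩ <;>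
  rcases h.eq_or_eq h1.symm with ⟨-, h3⟩ | ⟨-, h3⟩ <;>
  rcases h.eq_or_eq h2.symm with ⟨-, h4⟩ | ⟨-, h4⟩ <;> simp_all

theorem finite (h : IsGluing G G₁ u₁ v₁ G₂ u₂ v₂ f₁ f₂) [Finite V₁] [Finite V₂] : Finite V := by
  rw [← Set.finite_univ_iff, ← h.cover]
  exact (Set.finite_range f₁).union (Set.finite_range f₂)

theorem card_vert (h : IsGluing G G₁ u₁ v₁ G₂ u₂ v₂ f₁ f₂) [Finite V₁] [Finite V₂] :
    Nat.card V + 2 = Nat.card V₁ + Nat.card V₂ := by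
  have h1 := Set.ncard_union_add_ncard_inter (Set.range f₁) (Set.range f₂)
  rw [h.cover, h.overlap, Set.ncard_univ, Set.ncard_pair (f₁.injective.ne h.ne),
    ← Set.image_univ, ← Set.image_univ, Set.ncard_image_of_injective _ f₁.injective,
    Set.ncard_image_of_injective _ f₂.injective, Set.ncard_univ, Set.ncard_univ] at h1
  exact h1

theorem card_edge (h : IsGluing G G₁ u₁ v₁ G₂ u₂ v₂ f₁ f₂) [Finite V₁] [Finite V₂] :
    G.edgeSet.ncard + 1 = G₁.edgeSet.ncard + G₂.edgeSet.ncard := by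
  rw [h.edgeSet_eq, Set.ncard_union_eq h.disjoint_edges,
    Set.ncard_image_of_injective _ (Sym2.map.injective f₁.injective),
    Set.ncard_image_of_injective _ (Sym2.map.injective f₂.injective), add_assoc,
    Set.ncard_sdiff_singleton_add_one (show s(u₂, v₂) ∈ G₂.edgeSet from h.adj)]

open Classical in
/-- The lengths prescribed for the second piece of a gluing, once the squared distance `d` of the
glued vertices is known. -/
noncomputable def pieceLen (f₂ : V₂ ↪ V) (u₂ v₂ : V₂) (l : Sym2 V → ℂ) (d : ℂ) : Sym2 V₂ → ℂ :=
  Function.update (l ∘ Sym2.map f₂) s(u₂, v₂) d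

theorem pieceLen_self {l : Sym2 V → ℂ} {d : ℂ} : pieceLen f₂ u₂ v₂ l d s(u₂, v₂) = d := by
  classical
  exact Function.update_self ..

theorem pieceLen_of_ne {l : Sym2 V → ℂ} {d : ℂ} {e : Sym2 V₂} (he : e ≠ s(u₂, v₂)) :
    pieceLen f₂ u₂ v₂ l d e = l (e.map f₂) := by
  classical
  exact Function.update_of_ne he ..

theorem comp_mem₁ (h : IsGluing G G₁ u₁ v₁ G₂ u₂ v₂ f₁ f₂) {l : Sym2 V → ℂ} {q : V → ℂ × ℂ}
    (hq : q ∈ normalisedRealisations G l (f₁ u₁) (f₁ v₁)) :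
    q ∘ f₁ ∈ normalisedRealisations G₁ (l ∘ Sym2.map f₁) u₁ v₁ := by
  refine ⟨hq.1, fun e he => ?_⟩
  rw [len_comp]
  exact hq.2 (h.edgeSet_eq ▸ .inl ⟨e, he, rfl⟩)

theorem comp_mem₂ (h : IsGluing G G₁ u₁ v₁ G₂ u₂ v₂ f₁ f₂) {l : Sym2 V → ℂ} {q : V → ℂ × ℂ}
    (hq : q ∈ normalisedRealisations G l (f₁ u₁) (f₁ v₁)) :
    q ∘ f₂ ∈ normalisedRealisations G₂
      (pieceLen f₂ u₂ v₂ l (len (q ∘ f₁) s(u₁, v₁))) u₂ v₂ := by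
  refine ⟨by simpa [IsNormalised, h.glue_u, h.glue_v] using hq.1, fun e he => ?_⟩
  by_cases hne : e = s(u₂, v₂)
  · subst hne
    simp [pieceLen_self, h.glue_u, h.glue_v]
  · rw [len_comp, pieceLen_of_ne hne]
    exact hq.2 (h.edgeSet_eq ▸ .inr ⟨e, ⟨he, hne⟩, rfl⟩)

theorem exists_glued (h : IsGluing G G₁ u₁ v₁ G₂ u₂ v₂ f₁ f₂) {l : Sym2 V → ℂ} {q₁ : V₁ → ℂ × ℂ}
    (hq₁ : q₁ ∈ normalisedRealisations G₁ (l ∘ Sym2.map f₁) u₁ v₁) {q₂ : V₂ → ℂ × ℂ}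
    (hq₂ : q₂ ∈ normalisedRealisations G₂ (pieceLen f₂ u₂ v₂ l (len q₁ s(u₁, v₁))) u₂ v₂) :
    ∃ q ∈ normalisedRealisations G l (f₁ u₁) (f₁ v₁), q ∘ f₁ = q₁ ∧ q ∘ f₂ = q₂ := by
  -- The default `0` is never used, since `f₁` and `f₂` cover `V`.
  set q := Function.extend f₁ q₁ (Function.extend f₂ q₂ 0) with hq
  have h1 : q ∘ f₁ = q₁ := Function.extend_comp f₁.injective _ _
  have hu : q₁ u₁ = q₂ u₂ := hq₁.1.1.trans hq₂.1.1.symm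
  -- For normalised configurations the second coordinate of the second base vertex is the squared
  -- distance of the base pair, which is prescribed to match.
  have hv : q₁ v₁ = q₂ v₂ := by
    refine Prod.ext (hq₁.1.2.trans hq₂.1.2.symm) ?_
    have := hq₂.2 (show s(u₂, v₂) ∈ G₂.edgeSet from h.adj)
    simpa [pieceLen_self, hq₁.1.1, hq₁.1.2, hq₂.1.1, hq₂.1.2] using this.symm
  have h2 : q ∘ f₂ = q₂ := by
    funext y
    by_cases hy : ∃ x, f₁ x = f₂ y
    · obtain ⟨x, hx⟩ := hy
      rw [Function.comp_apply, ← hx]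
      change (q ∘ f₁) x = _
      rw [h1]
      rcases h.eq_or_eq hx with ⟨rfl, rfl⟩ | ⟨rfl, rfl⟩
      exacts [hu, hv]
    · rw [Function.comp_apply, hq, Function.extend_apply' _ _ _ hy, f₂.injective.extend_apply]
  refine ⟨q, ⟨?_, ?_⟩, h1, h2⟩
  · have := hq₁.1
    rwa [← h1] at this
  · rw [h.edgeSet_eq]
    rintro _ (⟨e, he, rfl⟩ | ⟨e, ⟨he, hne⟩, rfl⟩)
    · rw [← len_comp, h1]
      exact hq₁.2 he
    · rw [← len_comp, h2, hq₂.2 he, pieceLen_of_ne hne]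

theorem card_normalisedRealisations (h : IsGluing G G₁ u₁ v₁ G₂ u₂ v₂ f₁ f₂) {l : Sym2 V → ℂ}
    {m : ℕ} (hm : ∀ q₁ ∈ normalisedRealisations G₁ (l ∘ Sym2.map f₁) u₁ v₁,
      Nat.card (normalisedRealisations G₂ (pieceLen f₂ u₂ v₂ l (len q₁ s(u₁, v₁))) u₂ v₂) = m)
    (hm0 : m ≠ 0) :
    Nat.card (normalisedRealisations G l (f₁ u₁) (f₁ v₁)) =
      Nat.card (normalisedRealisations G₁ (l ∘ Sym2.map f₁) u₁ v₁) * m := by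
  let res (q : normalisedRealisations G l (f₁ u₁) (f₁ v₁)) :
      normalisedRealisations G₁ (l ∘ Sym2.map f₁) u₁ v₁ := ⟨q.1 ∘ f₁, h.comp_mem₁ q.2⟩
  have key (q₁ : normalisedRealisations G₁ (l ∘ Sym2.map f₁) u₁ v₁) :
      Nat.card {q // res q = q₁} = m := by
    rw [← hm q₁.1 q₁.2]
    let g (q : {q // res q = q₁}) : normalisedRealisations G₂
        (pieceLen f₂ u₂ v₂ l (len q₁.1 s(u₁, v₁))) u₂ v₂ :=
      ⟨q.1.1 ∘ f₂, by
        have : q.1.1 ∘ f₁ = q₁.1 := congrArg Subtype.val q.2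
        rw [← this]
        exact h.comp_mem₂ q.1.2⟩
    refine Nat.card_congr (Equiv.ofBijective g ⟨fun q q' hqq' => ?_, fun q₂ => ?_⟩)
    · refine Subtype.ext (Subtype.ext (funext fun v => ?_))
      have hv : v ∈ Set.range f₁ ∪ Set.range f₂ := h.cover ▸ Set.mem_univ v
      rcases hv with ⟨x, rfl⟩ | ⟨x, rfl⟩
      · exact congrFun (congrArg Subtype.val (q.2.trans q'.2.symm)) x
      · exact congrFun (congrArg Subtype.val hqq') x
    · obtain ⟨q, hq, hq1, hq2⟩ := h.exists_glued q₁.2 q₂.2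
      exact ⟨⟨⟨q, hq⟩, Subtype.ext hq1⟩, Subtype.ext hq2⟩
  exact Nat.card_eq_mul_of_card_fiber res hm0 key

end IsGluing

/-! ### The induction over quadratically solvable graphs -/

theorem AlgebraicIndepOn.comp_of_image {ι κ : Type*} {x : ι → ℂ} {f : κ → ι} {s : Set κ}
    (hf : Function.Injective f) (hx : AlgebraicIndepOn ℚ x (f '' s)) :
    AlgebraicIndepOn ℚ (x ∘ f) s :=
  AlgebraicIndependent.comp hx (fun e : s => ⟨f e, Set.mem_image_of_mem f e.2⟩) fun _ _ h =>
    Subtype.ext (hf (congrArg Subtype.val h))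

/-- With `d`, `A`, `B` the squared distances of `ab`, `va`, `vb`, the first coordinate `z` of `v`
satisfies `d z² - (A + d - B) z + A = 0`; then the second is `A + d - B - d z`. -/
theorem IsNormalised.coord_mem_acl_of_len {V : Type*} {a b v : V} {q : V → ℂ × ℂ} {S : Set ℂ}
    (hq : IsNormalised a b q) (hab : len q s(a, b) ≠ 0) (h : len q s(a, b) ∈ acl S)
    (ha : len q s(v, a) ∈ acl S) (hb : len q s(v, b) ∈ acl S) :
    (q v).1 ∈ acl S ∧ (q v).2 ∈ acl S := by
  have hd : len q s(a, b) = (q b).2 := by simp [hq.1, hq.2]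
  rw [hd] at hab h
  set A := len q s(v, a) with hA
  set B := len q s(v, b) with hB
  simp only [len_mk, hq.1, hq.2, Prod.fst_zero, Prod.snd_zero, sub_zero] at hA hB
  have h1 : (q v).1 ∈ acl S := by
    refine mem_acl_of_quadratic h (neg_mem (sub_mem (add_mem ha h) hb)) ha hab ?_
    linear_combination (1 - (q v).1) * hA + (q v).1 * hB
  have h2 : (q v).2 = A + (q b).2 - B - (q b).2 * (q v).1 := by
    linear_combination hB - hA
  exact ⟨h1, h2 ▸ sub_mem (sub_mem (add_mem ha h) hb) (mul_mem h h1)⟩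

/-- The properties of quadratically solvable graphs which are proved by induction: they have as many
edges as a minimally rigid graph, all squared distances are algebraic over the edge lengths, and the
number of normalised configurations with given algebraically independent edge lengths is
`2 ^ (n - 2)`. -/
structure HasQSProperties {V : Type*} (G : SimpleGraph V) : Prop where
  card_vert : 3 ≤ Nat.card V
  card_edge : G.edgeSet.ncard + 3 = 2 * Nat.card V
  len_mem : ∀ q : V → ℂ × ℂ, Function.Injective (fun v => (q v).1) →
    Function.Injective (fun v => (q v).2) → ∀ e, len q e ∈ acl (len q '' G.edgeSet)
  card_normalised : ∀ (l : Sym2 V → ℂ), AlgebraicIndepOn ℚ l G.edgeSet → ∀ a b, a ≠ b →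
    Nat.card (normalisedRealisations G l a b) = 2 ^ (Nat.card V - 2)

theorem HasQSProperties.finite {V : Type*} {G : SimpleGraph V} (h : HasQSProperties G) : Finite V :=
  Nat.finite_of_card_ne_zero (by have := h.card_vert; omega)

theorem exists_normalised_triangle {V : Type*} {a b c : V} (hab : a ≠ b) (hac : a ≠ c)
    (hbc : b ≠ c) (l : Sym2 V → ℂ) (hl : l s(a, b) ≠ 0) : ∃ q, IsNormalised a b q ∧
      len q s(a, b) = l s(a, b) ∧ len q s(a, c) = l s(a, c) ∧ len q s(b, c) = l s(b, c) := by
  classical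
  obtain ⟨s, hs⟩ := IsAlgClosed.exists_eq_mul_self
    (discrim (l s(a, b)) (-(l s(a, c) + l s(a, b) - l s(b, c))) (l s(a, c)))
  obtain ⟨z, hz⟩ := exists_quadratic_eq_zero hl ⟨s, hs⟩
  refine ⟨fun v => if v = a then 0 else if v = b then (1, l s(a, b)) else
    (z, l s(a, c) + l s(a, b) - l s(b, c) - l s(a, b) * z),
    ⟨by simp, by simp [hab.symm]⟩, ?_, ?_, ?_⟩
  · simp [hab.symm]
  · simp [hac.symm, hbc.symm]
    linear_combination -hz
  · simp [hac.symm, hbc.symm, hab.symm]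
    linear_combination -hz

theorem hasQSProperties_triangle {V : Type*} (hV : Nat.card V = 3) :
    HasQSProperties (⊤ : SimpleGraph V) := by
  classical
  have hfin : Finite V := Nat.finite_of_card_ne_zero (by omega)
  have := Fintype.ofFinite V
  have hE : (⊤ : SimpleGraph V).edgeSet.ncard + 3 = 2 * Nat.card V := by
    rw [← SimpleGraph.coe_edgeFinset, Set.ncard_coe_finset,
      SimpleGraph.card_edgeFinset_top_eq_card_choose_two, ← Nat.card_eq_fintype_card, hV]
    rfl
  refine ⟨hV.ge, hE, fun q _ _ e => ?_, fun l hl a b hab => ?_⟩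
  · induction e with | _ v w => ?_
    by_cases h : v = w
    · subst h; simp [zero_mem]
    · exact subset_acl _ ⟨s(v, w), h, rfl⟩
  · obtain ⟨c, hca, hcb, hc⟩ : ∃ c, c ≠ a ∧ c ≠ b ∧ ∀ v, v = a ∨ v = b ∨ v = c := by
      rw [← Set.ncard_univ, Set.ncard_eq_three] at hV
      obtain ⟨x, y, z, hxy, hxz, hyz, h⟩ := hV
      simp only [Set.ext_iff, Set.mem_univ, true_iff, Set.mem_insert_iff,
        Set.mem_singleton_iff] at h
      rcases h a with rfl | rfl | rfl <;> rcases h b with rfl | rfl | rfl <;>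
        first
        | exact absurd rfl hab
        | exact ⟨x, by tauto, by tauto, fun v => by have := h v; tauto⟩
        | exact ⟨y, by tauto, by tauto, fun v => by have := h v; tauto⟩
        | exact ⟨z, by tauto, by tauto, fun v => by have := h v; tauto⟩
    obtain ⟨q, hn, h1, h2, h3⟩ := exists_normalised_triangle hab hca.symm hcb.symm l
      (hl.ne_zero ⟨s(a, b), hab⟩)
    have heq : Set.EqOn (len q) l (⊤ : SimpleGraph V).edgeSet := by
      intro e he
      induction e with | _ v w => ?_
      have hvw : v ≠ w := he
      rcases hc v with rfl | rfl | rfl <;> rcases hc w with rfl | rfl | rfl <;>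
        first
        | exact absurd rfl hvw
        | assumption
        | (rw [Sym2.eq_swap]; assumption)
    have hgood : IsGood ⊤ q := ⟨hE, hV.ge, hl.congr heq.symm⟩
    -- All pairs are edges, so realisations with the given edge lengths are exactly those sharing
    -- all lengths with `q`: `q` and its mirror image.
    rw [hV, show 3 - 2 = 1 from rfl, pow_one, ← hgood.card_congruent hn]
    refine Nat.card_congr (Equiv.subtypeEquivRight fun q' => and_congr_right fun _ => ?_)
    refine ⟨fun h => funext fun e => ?_, fun h => h ▸ heq⟩
    induction e with | _ v w => ?_
    by_cases hvw : v = w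
    · subst hvw; simp
    · have he : s(v, w) ∈ (⊤ : SimpleGraph V).edgeSet := hvw
      exact (h he).trans (heq he).symm

section glue

variable {V V₁ V₂ : Type u} {G : SimpleGraph V} {G₁ : SimpleGraph V₁} {G₂ : SimpleGraph V₂}
  {u₁ v₁ : V₁} {u₂ v₂ : V₂} {f₁ : V₁ ↪ V} {f₂ : V₂ ↪ V}

theorem IsGluing.indepOn₁ (h : IsGluing G G₁ u₁ v₁ G₂ u₂ v₂ f₁ f₂) {l : Sym2 V → ℂ}
    (hl : AlgebraicIndepOn ℚ l G.edgeSet) : AlgebraicIndepOn ℚ (l ∘ Sym2.map f₁) G₁.edgeSet := by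
  rw [h.edgeSet_eq] at hl
  exact (hl.mono Set.subset_union_left).comp_of_image (Sym2.map.injective f₁.injective)

/-- The new length `d` lies in the closure of the `G₁`-lengths but not of `∅`, so it avoids the
closure of the disjoint, independent `G₂`-lengths and can be adjoined to them. -/
theorem IsGluing.indepOn₂ (h : IsGluing G G₁ u₁ v₁ G₂ u₂ v₂ f₁ f₂) [Finite V₁] [Finite V₂]
    {l : Sym2 V → ℂ} (hl : AlgebraicIndepOn ℚ l G.edgeSet) {q₁ : V₁ → ℂ × ℂ} (hq₁ : IsGood G₁ q₁)
    (heq : Set.EqOn (len q₁) (l ∘ Sym2.map f₁) G₁.edgeSet) :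
    AlgebraicIndepOn ℚ (pieceLen f₂ u₂ v₂ l (len q₁ s(u₁, v₁))) G₂.edgeSet := by
  have he : s(u₂, v₂) ∈ G₂.edgeSet := h.adj
  rw [h.edgeSet_eq] at hl
  have hd : len q₁ s(u₁, v₁) ∈ acl (l '' (Sym2.map f₁ '' G₁.edgeSet)) := by
    have := hq₁.len_mem s(u₁, v₁)
    rwa [heq.image_eq, Set.image_comp] at this
  have hd' := notMem_acl_image_of_disjoint (Set.toFinite _) h.disjoint_edges hl hd
    (hq₁.len_notMem h.ne)
  have hcongr : Set.EqOn (l ∘ Sym2.map f₂) (pieceLen f₂ u₂ v₂ l (len q₁ s(u₁, v₁)))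
      (G₂.edgeSet \ {s(u₂, v₂)}) := fun e he => (pieceLen_of_ne he.2).symm
  rw [← Set.insert_sdiff_self_of_mem he, AlgebraicIndepOn.insert_iff (by simp)]
  refine ⟨AlgebraicIndepOn.congr ?_ hcongr, ?_⟩
  · exact (hl.mono Set.subset_union_right).comp_of_image (Sym2.map.injective f₂.injective)
  · rw [← hcongr.image_eq, pieceLen_self, Set.image_comp]
    exact hd'

/-- Each point is located by its distances to the glued pair, all measured within one piece.
Injectivity of both coordinates keeps the distance of that pair nonzero without assuming independent
edge lengths, which for generic realisations is deduced from this. -/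
theorem IsGluing.len_mem (h : IsGluing G G₁ u₁ v₁ G₂ u₂ v₂ f₁ f₂) (h₁ : HasQSProperties G₁)
    (h₂ : HasQSProperties G₂) {q : V → ℂ × ℂ} (hq1 : Function.Injective (fun v => (q v).1))
    (hq2 : Function.Injective (fun v => (q v).2)) (e : Sym2 V) :
    len q e ∈ acl (len q '' G.edgeSet) := by
  set S := len q '' G.edgeSet with hS
  have hm1 (x y : V₁) : len q s(f₁ x, f₁ y) ∈ acl S := by
    have := h₁.len_mem (q ∘ f₁) (hq1.comp f₁.injective) (hq2.comp f₁.injective) s(x, y)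
    refine acl_mono ?_ this
    rintro _ ⟨e, he, rfl⟩
    exact ⟨e.map f₁, h.edgeSet_eq ▸ .inl ⟨e, he, rfl⟩, (len_comp ..).symm⟩
  have hm2 (x y : V₂) : len q s(f₂ x, f₂ y) ∈ acl S := by
    have := h₂.len_mem (q ∘ f₂) (hq1.comp f₂.injective) (hq2.comp f₂.injective) s(x, y)
    refine acl_le ?_ this
    rintro _ ⟨e, he, rfl⟩
    rw [len_comp]
    by_cases hne : e = s(u₂, v₂)
    · subst hne
      have := hm1 u₁ v₁
      rwa [h.glue_u, h.glue_v] at this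
    · exact subset_acl _ ⟨e.map f₂, h.edgeSet_eq ▸ .inr ⟨e, ⟨he, hne⟩, rfl⟩, rfl⟩
  have hab : f₁ u₁ ≠ f₁ v₁ := f₁.injective.ne h.ne
  have hab' : (q (f₁ u₁)).1 ≠ (q (f₁ v₁)).1 := hq1.ne hab
  have hab'' : (q (f₁ u₁)).2 ≠ (q (f₁ v₁)).2 := hq2.ne hab
  have hd : len q s(f₁ u₁, f₁ v₁) ≠ 0 := mul_ne_zero (sub_ne_zero.2 hab') (sub_ne_zero.2 hab'')
  rw [← len_renorm hab'] at hd ⊢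
  refine len_mem_acl (fun v => ?_) e
  refine (isNormalised_renorm hab').coord_mem_acl_of_len hd ?_ ?_ ?_ <;> rw [len_renorm hab']
  · exact hm1 _ _
  all_goals
    have hv : v ∈ Set.range f₁ ∪ Set.range f₂ := h.cover ▸ Set.mem_univ v
    rcases hv with ⟨x, rfl⟩ | ⟨x, rfl⟩
    · exact hm1 _ _
    · simp only [h.glue_u, h.glue_v]
      exact hm2 _ _

theorem HasQSProperties.glue (h₁ : HasQSProperties G₁) (h₂ : HasQSProperties G₂)
    (h : IsGluing G G₁ u₁ v₁ G₂ u₂ v₂ f₁ f₂) : HasQSProperties G := by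
  have := h₁.finite
  have := h₂.finite
  have := h.finite
  have hV := h.card_vert
  have hE := h.card_edge
  have hV₁ := h₁.card_vert
  have hV₂ := h₂.card_vert
  have hE₁ := h₁.card_edge
  have hE₂ := h₂.card_edge
  have hE' : G.edgeSet.ncard + 3 = 2 * Nat.card V := by omega
  refine ⟨by omega, hE', fun q hq1 hq2 e => h.len_mem h₁ h₂ hq1 hq2 e, fun l hl a b hab => ?_⟩
  -- The count does not depend on the base pair, so normalise at the glued pair; the exponents add
  -- up because `n + 2 = n₁ + n₂`.
  rw [card_normalisedRealisations_eq hE' (by omega) hl hab (f₁.injective.ne h.ne),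
    h.card_normalisedRealisations (m := 2 ^ (Nat.card V₂ - 2)) (fun q₁ hq₁ => ?_) (by positivity),
    h₁.card_normalised _ (h.indepOn₁ hl) _ _ h.ne, ← pow_add]
  · congr 1
    omega
  · exact h₂.card_normalised _ (h.indepOn₂ hl
      ⟨hE₁, hV₁, (h.indepOn₁ hl).congr hq₁.2.symm⟩ hq₁.2) _ _ h.adj.ne

end glue

theorem IsQS.hasQSProperties {V : Type u} {G : SimpleGraph V} (h : IsQS G) :
    HasQSProperties G := by
  induction h with
  | triangle hV => exact hasQSProperties_triangle hV
  | glue _ _ h h₁ h₂ => exact h₁.glue h₂ h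

/-! ### From realisations in `ℂ²` to normalised configurations -/

/-- The isotropic coordinates `(x + iy, x - iy)` of the points of a realisation. -/
noncomputable def isotropic {V : Type*} : (V → Fin 2 → ℂ) ≃ (V → ℂ × ℂ) where
  toFun p v := (p v 0 + Complex.I * p v 1, p v 0 - Complex.I * p v 1)
  invFun q v := ![((q v).1 + (q v).2) / 2, ((q v).1 - (q v).2) / (2 * Complex.I)]
  left_inv p := by
    funext v i
    fin_cases i
    · simp
    · simp only [Fin.mk_one, Matrix.cons_val_one, Matrix.cons_val_fin_one]
      field_simp
      ring
  right_inv q := by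
    funext v
    ext
    · simp only [Matrix.cons_val_zero, Matrix.cons_val_one, Matrix.cons_val_fin_one]
      field_simp
      ring
    · simp only [Matrix.cons_val_zero, Matrix.cons_val_one, Matrix.cons_val_fin_one]
      field_simp
      ring

theorem len_isotropic {V : Type*} (p : V → Fin 2 → ℂ) (v w : V) :
    len (isotropic p) s(v, w) = sqLength (p v - p w) := by
  simp only [len_mk, isotropic, Equiv.coe_fn_mk, sqLength, Pi.sub_apply]
  linear_combination -(p v 1 - p w 1) ^ 2 * Complex.I_sq

theorem areEquivalent_iff {V : Type u} {G : SimpleGraph V} {p q : V → Fin 2 → ℂ} :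
    AreEquivalent G p q ↔ Set.EqOn (len (isotropic q)) (len (isotropic p)) G.edgeSet := by
  constructor
  · intro h e he
    induction e with | _ v w => ?_
    rw [len_isotropic, len_isotropic]
    exact (h v w he).symm
  · intro h v w hvw
    have := h (show s(v, w) ∈ G.edgeSet from hvw)
    rw [len_isotropic, len_isotropic] at this
    exact this.symm

theorem areCongruent_iff {V : Type u} {p q : V → Fin 2 → ℂ} :
    AreCongruent p q ↔ len (isotropic p) = len (isotropic q) := by
  constructor
  · intro h
    funext e
    induction e with | _ v w => ?_
    rw [len_isotropic, len_isotropic]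
    exact h v w
  · intro h v w
    rw [← len_isotropic, ← len_isotropic, h]

theorem IsGeneric.notMem_acl {V : Type u} {p : V → Fin 2 → ℂ} (hp : IsGeneric p) {v w : V}
    (hvw : v ≠ w) : p v 0 ∉ acl {p w 0, p w 1, p v 1} := by
  have := AlgebraicIndependent.notMem_acl hp (s := {(w, 0), (w, 1), (v, 1)}) (i := (v, 0))
    (by simp [hvw])
  simpa [Set.image_insert_eq] using this

theorem IsGeneric.injective_fst {V : Type u} {p : V → Fin 2 → ℂ} (hp : IsGeneric p) :
    Function.Injective (fun v => (isotropic p v).1) := by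
  intro v w h
  by_contra hvw
  refine hp.notMem_acl hvw ?_
  have h' : p v 0 = p w 0 + Complex.I * p w 1 - Complex.I * p v 1 := by
    simp only [isotropic, Equiv.coe_fn_mk] at h
    linear_combination h
  have hI := I_mem_acl {p w 0, p w 1, p v 1}
  have hs := subset_acl {p w 0, p w 1, p v 1}
  generalize acl {p w 0, p w 1, p v 1} = K at *
  rw [h']
  exact sub_mem (add_mem (hs (by simp)) (mul_mem hI (hs (by simp)))) (mul_mem hI (hs (by simp)))

theorem IsGeneric.injective_snd {V : Type u} {p : V → Fin 2 → ℂ} (hp : IsGeneric p) :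
    Function.Injective (fun v => (isotropic p v).2) := by
  intro v w h
  by_contra hvw
  refine hp.notMem_acl hvw ?_
  have h' : p v 0 = p w 0 - Complex.I * p w 1 + Complex.I * p v 1 := by
    simp only [isotropic, Equiv.coe_fn_mk] at h
    linear_combination h
  have hI := I_mem_acl {p w 0, p w 1, p v 1}
  have hs := subset_acl {p w 0, p w 1, p v 1}
  generalize acl {p w 0, p w 1, p v 1} = K at *
  rw [h']
  exact add_mem (sub_mem (hs (by simp)) (mul_mem hI (hs (by simp)))) (mul_mem hI (hs (by simp)))

theorem HasQSProperties.exists_ne {V : Type*} {G : SimpleGraph V} (hG : HasQSProperties G) :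
    ∃ a b : V, a ≠ b := by
  have := hG.finite
  have : Nontrivial V := by
    rw [← Finite.one_lt_card_iff_nontrivial]
    have := hG.card_vert
    omega
  exact exists_pair_ne V

/-- The edge lengths of a generic realisation are algebraically independent. -/
theorem HasQSProperties.isGood {V : Type u} {G : SimpleGraph V} (hG : HasQSProperties G)
    {p : V → Fin 2 → ℂ} (hp : IsGeneric p) : IsGood G (isotropic p) := by
  refine ⟨hG.card_edge, hG.card_vert, ?_⟩
  have := hG.finite
  obtain ⟨a, b, hab⟩ := hG.exists_ne
  set q := isotropic p with hq
  have hab1 : (q a).1 ≠ (q b).1 := hp.injective_fst.ne hab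
  have hab2 : (q a).2 ≠ (q b).2 := hp.injective_snd.ne hab
  -- The three extra numbers undo the normalisation at `a, b`. With the `2n - 3` edge lengths they
  -- form a family of size `2n` over which all `2n` generic coordinates are algebraic.
  let y : G.edgeSet ⊕ Fin 3 → ℂ :=
    Sum.elim (fun e => len q e) ![(q a).1, (q a).2, (q b).1 - (q a).1]
  set S := Set.range y with hS
  have hya : (q a).1 ∈ acl S := subset_acl _ ⟨.inr 0, rfl⟩
  have hya' : (q a).2 ∈ acl S := subset_acl _ ⟨.inr 1, rfl⟩
  have hyb : (q b).1 - (q a).1 ∈ acl S := subset_acl _ ⟨.inr 2, rfl⟩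
  have hlen (e : Sym2 V) : len q e ∈ acl S := by
    refine acl_mono ?_ (hG.len_mem q hp.injective_fst hp.injective_snd e)
    rintro _ ⟨e, he, rfl⟩
    exact ⟨.inl ⟨e, he⟩, rfl⟩
  have hcoord (v : V) : (q v).1 ∈ acl S ∧ (q v).2 ∈ acl S := by
    have h := (isNormalised_renorm hab1).coord_mem_acl_of_len (v := v) (S := S)
      (by rw [len_renorm hab1]; exact mul_ne_zero (sub_ne_zero.2 hab1) (sub_ne_zero.2 hab2))
      (by rw [len_renorm hab1]; exact hlen _) (by rw [len_renorm hab1]; exact hlen _)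
      (by rw [len_renorm hab1]; exact hlen _)
    have h0 : (q b).1 - (q a).1 ≠ 0 := sub_ne_zero.2 hab1.symm
    have e1 : (q v).1 = (renorm a b q v).1 * ((q b).1 - (q a).1) + (q a).1 := by
      simp only [renorm]; field_simp; ring
    have e2 : (q v).2 = (renorm a b q v).2 / ((q b).1 - (q a).1) + (q a).2 := by
      simp only [renorm]; field_simp; ring
    rw [e1, e2]
    exact ⟨add_mem (mul_mem h.1 hyb) hya, add_mem (div_mem h.2 hyb) hya'⟩
  have hy := (algebraicIndependent_of_subset_acl (y := y) hp (by
    rintro _ ⟨⟨v, i⟩, rfl⟩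
    obtain ⟨h1, h2⟩ := hcoord v
    have h2' : (2 : ℂ) ∈ acl S := ofNat_mem _ 2
    have hp' : p v = isotropic.symm q v := by rw [hq, Equiv.symm_apply_apply]
    simp only [hp']
    fin_cases i
    · exact div_mem (add_mem h1 h2) h2'
    · exact div_mem (sub_mem h1 h2) (mul_mem h2' (I_mem_acl S))) (by
    have h1 := hG.card_edge
    have h2 : Nat.card G.edgeSet = G.edgeSet.ncard := Nat.card_coe_set_eq _
    rw [Nat.card_sum, Nat.card_prod, Nat.card_fin, Nat.card_fin]
    omega)).1
  exact hy.comp Sum.inl Sum.inl_injective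

/-- Every congruence class is represented by exactly two normalised configurations. -/
theorem IsGood.card_normalisedRealisations {V : Type u} [Finite V] {G : SimpleGraph V}
    {p : V → Fin 2 → ℂ} (hp : IsGood G (isotropic p)) {a b : V} (hab : a ≠ b) :
    Nat.card (normalisedRealisations G (len (isotropic p)) a b) =
      Nat.card (Quotient (congruenceSetoid G p)) * 2 := by
  let f (q : normalisedRealisations G (len (isotropic p)) a b) :
      Quotient (congruenceSetoid G p) :=
    ⟦⟨isotropic.symm q.1, areEquivalent_iff.2 (by rw [Equiv.apply_symm_apply]; exact q.2.2)⟩⟧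
  refine Nat.card_eq_mul_of_card_fiber f two_ne_zero fun c => ?_
  induction c using Quotient.inductionOn with | _ r => ?_
  have hr := areEquivalent_iff.1 r.2
  have hgood : IsGood G (isotropic r.1) := ⟨hp.1, hp.2, hp.3.congr hr.symm⟩
  have h := hgood.fst_ne hab
  -- The fibre over the class of `r` consists of the normalised configurations with all lengths of
  -- `r`, namely its normalisation and the mirror image of that.
  have hf (q) : f q = ⟦r⟧ ↔ len q.1 = len (_root_.renorm a b (isotropic r.1)) := by
    rw [len_renorm h, Quotient.eq]
    change AreCongruent _ _ ↔ _
    rw [areCongruent_iff, Equiv.apply_symm_apply]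
  refine (Nat.card_congr ?_).trans ((hgood.renorm h).card_congruent (isNormalised_renorm h))
  exact
    { toFun := fun q => ⟨q.1.1, q.1.2.1, (hf q.1).1 q.2⟩
      invFun := fun q => ⟨⟨q.1, q.2.1, by rw [q.2.2, len_renorm h]; exact hr⟩, (hf _).2 q.2.2⟩
      left_inv := fun _ => rfl
      right_inv := fun _ => rfl }

theorem mainTheorem4 {V : Type u} [Fintype V] (G : SimpleGraph V) (hG : IsQS G) :
    GenericComplexCountEq G (2 ^ (Fintype.card V - 3)) := by
  refine ⟨?_, fun p hp => ?_⟩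
  · obtain ⟨x, hx⟩ := exists_algebraicIndependent_complex (V × Fin 2)
    exact ⟨fun v i => x (v, i), hx⟩
  · have h := hG.hasQSProperties
    obtain ⟨a, b, hab⟩ := h.exists_ne
    have hgood := h.isGood hp
    have h1 := hgood.card_normalisedRealisations hab
    rw [h.card_normalised _ hgood.indep a b hab] at h1
    have h2 : Nat.card V - 2 = (Fintype.card V - 3) + 1 := by
      have := h.card_vert
      rw [Nat.card_eq_fintype_card] at *
      omega
    rw [h2, pow_succ] at h1
    have h3 := (Nat.eq_of_mul_eq_mul_right two_pos h1).symm
    -- A nonzero `Nat.card` excludes infinitely many classes, where the `ℕ∞`-valued count would be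
    -- `⊤`.
    have : Finite (Quotient (congruenceSetoid G p)) :=
      Nat.finite_of_card_ne_zero (h3 ▸ by positivity)
    rw [complexCount, ENat.card_eq_coe_natCard, h3]
    norm_cast
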